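/- Let $K$ be a number field and let $\Omega$ be any field extension of $K$ (for instance an algebraic closure of $K$). For a finite extension $L/K$ inside $\Omega$ let $\mathcal{A}(L)$ denote the set of nonzero prime ideals $\mathfrak{p}$ of the ring of integers $\mathcal{O}_K$ that split completely in $L$, that is, such that every prime $\mathfrak{P}$ of $\mathcal{O}_L$ above $\mathfrak{p}$ has ramification index $e(\mathfrak{P}|\mathfrak{p})=1$ and inertia degree $f(\mathfrak{P}|\mathfrak{p})=1$. Then a finite normal extension of $K$ in $\Omega$ is uniquely determined by the set of primes of $K$ that split completely in it: if $L,L'\subseteq\Omega$ are finite normal extensions of $K$ with $\mathcal{A}(L)=\mathcal{A}(L')$, then $L=L'$. Moreover, $L\mapsto\mathcal{A}(L)$ is an inclusion-reversing one-to-one correspondence between the finite normal extensions $L$ of $K$ in $\Omega$ and the sets of primes of $K$ of the form $\mathcal{A}(L)$ with $L$ such an extension: it is a bijection, and for all such $L,L'$ one has $L\subseteq L'$ if and only if $\mathcal{A}(L')\subseteq\mathcal{A}(L)$. -/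

import Mathlib

open scoped NumberField

/-- The set of (nonzero) primes `p` of `K` that split completely in `L`: every prime `P` of `𝓞 L`
lying over `p` has ramification index `e(P|p) = 1` and inertia degree `f(P|p) = 1`. -/
def splittingPrimes (K L : Type*) [Field K] [Field L] [Algebra K L] :
    Set (IsDedekindDomain.HeightOneSpectrum (𝓞 K)) :=
  {p | ∀ P ∈ p.asIdeal.primesOver (𝓞 L),
    P.ramificationIdx (𝓞 K) = 1 ∧ P.inertiaDeg (𝓞 K) = 1}

/-- The finite normal extensions of `K` inside a field extension `Ω` of `K`. -/
def finiteNormalExtensions (K Ω : Type*) [Field K] [Field Ω] [Algebra K Ω] :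
    Set (IntermediateField K Ω) :=
  {L | FiniteDimensional K L ∧ Normal K L}

open IsDedekindDomain Filter Topology

section EulerProduct

theorem summable_comp_asIdeal {R : Type*} [CommRing R] {g : Ideal R →*₀ ℝ}
    (hsum : Summable g) :
    Summable fun v : HeightOneSpectrum R ↦ g v.asIdeal :=
  hsum.comp_injective fun _ _ h ↦ HeightOneSpectrum.ext h

theorem tsum_pos_of_nonneg {R : Type*} [CommRing R] {g : Ideal R →*₀ ℝ}
    (hg : ∀ I, 0 ≤ g I) (hsum : Summable g) : 0 < ∑' I, g I :=
  hsum.tsum_pos hg 1 (by simp only [map_one, zero_lt_one])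

variable {R : Type*} [CommRing R] [IsDedekindDomain R]

theorem count_normalizedFactors_prod_pow (F : Finset (HeightOneSpectrum R)) (k : F → ℕ) (j : F) :
    letI := Classical.decEq (Ideal R)
    (UniqueFactorizationMonoid.normalizedFactors
      (∏ i : F, i.1.asIdeal ^ k i)).count j.1.asIdeal = k j := by
  classical
  have h : ∏ i : F, i.1.asIdeal ^ k i =
      (∑ i : F, Multiset.replicate (k i) i.1.asIdeal).prod := by
    simp [Multiset.prod_sum]
  rw [h, UniqueFactorizationMonoid.normalizedFactors_prod_of_prime]
  · rw [Multiset.count_sum', Finset.sum_eq_single j]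
    · simp
    · intro b _ hb
      rw [Multiset.count_replicate, if_neg]
      exact fun h ↦ hb (Subtype.ext (HeightOneSpectrum.ext h))
    · simp
  · intro p hp
    obtain ⟨i, -, hi⟩ := Multiset.mem_sum.mp hp
    rw [Multiset.eq_of_mem_replicate hi]
    exact i.1.prime

theorem prod_pow_asIdeal_injective (F : Finset (HeightOneSpectrum R)) :
    Function.Injective fun k : F → ℕ ↦ ∏ i : F, i.1.asIdeal ^ k i := by
  intro k l h
  funext j
  rw [← count_normalizedFactors_prod_pow F k j, ← count_normalizedFactors_prod_pow F l j]
  simp only at h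
  rw [h]

theorem exists_prod_pow_asIdeal_eq {I : Ideal R} (hI : I ≠ ⊥) {F : Finset (HeightOneSpectrum R)}
    (hF : ∀ v : HeightOneSpectrum R, v.asIdeal ∣ I → v ∈ F) :
    ∃ k : F → ℕ, ∏ i : F, i.1.asIdeal ^ k i = I := by
  classical
  refine ⟨fun i ↦ (Associates.mk i.1.asIdeal).count (Associates.mk I).factors, ?_⟩
  conv_rhs => rw [← Ideal.finprod_heightOneSpectrum_factorization hI]
  rw [finprod_eq_prod_of_mulSupport_subset (s := F)]
  · rw [← Finset.prod_coe_sort F fun v ↦ v.maxPowDividing I]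
    rfl
  · intro v hv
    refine hF v ?_
    by_contra hdvd
    apply hv
    have := (Associates.count_ne_zero_iff_dvd hI v.irreducible).not.mpr hdvd
    simp only [not_not] at this
    simp [HeightOneSpectrum.maxPowDividing, this]

variable (g : Ideal R →*₀ ℝ)

open scoped Classical in
theorem prod_sum_range_pow_eq (F : Finset (HeightOneSpectrum R)) (m : ℕ) :
    ∏ i : F, ∑ k ∈ Finset.range m, g i.1.asIdeal ^ k =
      ∑ I ∈ (Fintype.piFinset fun _ : F ↦ Finset.range m).map ⟨_, prod_pow_asIdeal_injective F⟩,
        g I := by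
  simp [Finset.prod_univ_sum, -Finset.univ_eq_attach]

variable {g}

theorem prod_one_sub_inv_le_tsum (hg : ∀ I, 0 ≤ g I)
    (hlt : ∀ v : HeightOneSpectrum R, g v.asIdeal < 1)
    (hsum : Summable g) (F : Finset (HeightOneSpectrum R)) :
    ∏ v ∈ F, (1 - g v.asIdeal)⁻¹ ≤ ∑' I, g I := by
  have : Tendsto (fun m : ℕ ↦ ∏ i : F, ∑ k ∈ Finset.range m, g i.1.asIdeal ^ k) atTop
      (𝓝 (∏ i : F, (1 - g i.1.asIdeal)⁻¹)) :=
    tendsto_finsetProd _ fun i _ ↦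
      (hasSum_geometric_of_lt_one (hg _) (hlt i.1)).tendsto_sum_nat
  rw [← Finset.prod_coe_sort F fun v ↦ (1 - g v.asIdeal)⁻¹]
  refine le_of_tendsto this (Eventually.of_forall fun m ↦ ?_)
  rw [prod_sum_range_pow_eq]
  exact hsum.sum_le_tsum _ fun I _ ↦ hg I

theorem exists_sum_le_prod_one_sub_inv (hg : ∀ I, 0 ≤ g I)
    (hlt : ∀ v : HeightOneSpectrum R, g v.asIdeal < 1) (T : Finset (Ideal R)) :
    ∃ F : Finset (HeightOneSpectrum R), ∑ I ∈ T, g I ≤ ∏ v ∈ F, (1 - g v.asIdeal)⁻¹ := by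
  classical
  have hfin (I : Ideal R) : ∃ F : Finset (HeightOneSpectrum R), I ≠ ⊥ →
      ∀ v : HeightOneSpectrum R, v.asIdeal ∣ I → v ∈ F := by
    by_cases hI : I = ⊥
    · exact ⟨∅, fun h ↦ (h hI).elim⟩
    · exact ⟨(Ideal.finite_factors hI).toFinset, fun _ v hv ↦ by simpa using hv⟩
  choose F₀ hF₀ using hfin
  let F := T.biUnion F₀
  refine ⟨F, ?_⟩
  have hk (I : Ideal R) : ∃ k : F → ℕ, I ∈ T → I ≠ ⊥ → ∏ i : F, i.1.asIdeal ^ k i = I := by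
    by_cases h : I ∈ T ∧ I ≠ ⊥
    · obtain ⟨k, hk⟩ := exists_prod_pow_asIdeal_eq h.2 (F := F)
        fun v hv ↦ Finset.mem_biUnion.mpr ⟨I, h.1, hF₀ I h.2 v hv⟩
      exact ⟨k, fun _ _ ↦ hk⟩
    · exact ⟨0, fun h1 h2 ↦ (h ⟨h1, h2⟩).elim⟩
  choose k hk using hk
  let m := T.sup fun I ↦ Finset.univ.sup (k I)
  rw [← Finset.sum_filter_ne_zero]
  calc ∑ I ∈ T with g I ≠ 0, g I
      ≤ ∏ i : F, ∑ k ∈ Finset.range (m + 1), g i.1.asIdeal ^ k := by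
        rw [prod_sum_range_pow_eq]
        refine Finset.sum_le_sum_of_subset_of_nonneg (fun I hI ↦ ?_) fun I _ _ ↦ hg I
        obtain ⟨hIT, hI0⟩ := Finset.mem_filter.mp hI
        have hbot : I ≠ ⊥ := fun h ↦ hI0 (by rw [h, ← Ideal.zero_eq_bot, map_zero])
        refine Finset.mem_map.mpr ⟨k I, Fintype.mem_piFinset.mpr fun i ↦ ?_, hk I hIT hbot⟩
        rw [Finset.mem_range, Nat.lt_succ_iff]
        exact (Finset.le_sup (f := k I) (Finset.mem_univ i)).trans
          (Finset.le_sup (f := fun I ↦ Finset.univ.sup (k I)) hIT)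
    _ ≤ ∏ v ∈ F, (1 - g v.asIdeal)⁻¹ := by
        rw [← Finset.prod_coe_sort F fun v ↦ (1 - g v.asIdeal)⁻¹]
        refine Finset.prod_le_prod (fun i _ ↦ Finset.sum_nonneg fun k _ ↦ pow_nonneg (hg _) k)
          fun i _ ↦ ?_
        exact sum_le_hasSum _ (fun k _ ↦ pow_nonneg (hg _) k)
          (hasSum_geometric_of_lt_one (hg _) (hlt i.1))

theorem Real.exp_le_inv_one_sub {x : ℝ} (hx : x < 1) : Real.exp x ≤ (1 - x)⁻¹ := by
  rw [le_inv_comm₀ (Real.exp_pos x) (by linarith), ← Real.exp_neg]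
  linarith [Real.add_one_le_exp (-x)]

theorem Real.inv_one_sub_le_exp {x : ℝ} (hx : x ≤ 1 / 2) :
    (1 - x)⁻¹ ≤ Real.exp (x + 2 * x ^ 2) := by
  refine le_trans ?_ (Real.add_one_le_exp _)
  rw [inv_le_iff_one_le_mul₀ (by linarith)]
  nlinarith [mul_nonneg (sq_nonneg x) (show 0 ≤ 1 - 2 * x by linarith)]

/-- The sum of `g` over the primes is at most the logarithm of its sum over all ideals. -/
theorem tsum_asIdeal_le_log_tsum (hg : ∀ I, 0 ≤ g I)
    (hlt : ∀ v : HeightOneSpectrum R, g v.asIdeal < 1) (hsum : Summable g) :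
    ∑' v : HeightOneSpectrum R, g v.asIdeal ≤ Real.log (∑' I, g I) := by
  refine (summable_comp_asIdeal hsum).tsum_le_of_sum_le fun F ↦ ?_
  rw [Real.le_log_iff_exp_le (tsum_pos_of_nonneg hg hsum), Real.exp_sum]
  exact (Finset.prod_le_prod (fun _ _ ↦ (Real.exp_pos _).le)
    fun v _ ↦ Real.exp_le_inv_one_sub (hlt v)).trans (prod_one_sub_inv_le_tsum hg hlt hsum F)

/-- The logarithm of the sum of `g` over all ideals is at most its sum over the primes, up to
an error that is quadratic in `g`. -/
theorem log_tsum_le_tsum_asIdeal (hg : ∀ I, 0 ≤ g I)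
    (hle : ∀ v : HeightOneSpectrum R, g v.asIdeal ≤ 1 / 2) (hsum : Summable g) :
    Real.log (∑' I, g I) ≤
      ∑' v : HeightOneSpectrum R, g v.asIdeal +
        2 * ∑' v : HeightOneSpectrum R, g v.asIdeal ^ 2 := by
  have h1 := summable_comp_asIdeal hsum
  have h2 : Summable fun v : HeightOneSpectrum R ↦ g v.asIdeal ^ 2 :=
    h1.of_nonneg_of_le (fun v ↦ sq_nonneg _) fun v ↦ by nlinarith [hg v.asIdeal, hle v]
  rw [Real.log_le_iff_le_exp (tsum_pos_of_nonneg hg hsum)]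
  refine hsum.tsum_le_of_sum_le fun T ↦ ?_
  obtain ⟨F, hF⟩ := exists_sum_le_prod_one_sub_inv hg (fun v ↦ (hle v).trans_lt (by norm_num)) T
  refine hF.trans <| (Finset.prod_le_prod (fun v _ ↦ inv_nonneg.mpr (by linarith [hle v]))
    fun v _ ↦ Real.inv_one_sub_le_exp (hle v)).trans ?_
  rw [← Real.exp_sum, Real.exp_le_exp, ← tsum_mul_left, ← h1.tsum_add (h2.mul_left 2)]
  exact (h1.add (h2.mul_left 2)).sum_le_tsum F fun v _ ↦ by have := hg v.asIdeal; positivity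

end EulerProduct

section DedekindZeta

variable (K : Type*) [Field K] [NumberField K]

/-- The multiplicative function `I ↦ N(I) ^ (-s)` on the ideals of `𝓞 K`. -/
noncomputable def idealNormRpow (s : ℝ) (hs : s ≠ 0) : Ideal (𝓞 K) →*₀ ℝ where
  toFun I := (Ideal.absNorm I : ℝ) ^ (-s)
  map_zero' := by simp [Real.zero_rpow (neg_ne_zero.mpr hs)]
  map_one' := by simp
  map_mul' I J := by
    rw [map_mul, Nat.cast_mul, Real.mul_rpow (Nat.cast_nonneg _) (Nat.cast_nonneg _)]

variable {K}

theorem two_le_absNorm_asIdeal (v : HeightOneSpectrum (𝓞 K)) :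
    2 ≤ Ideal.absNorm v.asIdeal := by
  have h0 : Ideal.absNorm v.asIdeal ≠ 0 := Ideal.absNorm_eq_zero_iff.not.mpr v.ne_bot
  have h1 : Ideal.absNorm v.asIdeal ≠ 1 := Ideal.absNorm_eq_one_iff.not.mpr v.isPrime.ne_top
  omega

theorem absNorm_asIdeal_rpow_le_half (v : HeightOneSpectrum (𝓞 K)) {s : ℝ} (hs : 1 ≤ s) :
    (Ideal.absNorm v.asIdeal : ℝ) ^ (-s) ≤ 1 / 2 := by
  have h2 : (2 : ℝ) ≤ Ideal.absNorm v.asIdeal := by exact_mod_cast two_le_absNorm_asIdeal v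
  calc (Ideal.absNorm v.asIdeal : ℝ) ^ (-s) ≤ (Ideal.absNorm v.asIdeal : ℝ) ^ (-1 : ℝ) :=
        Real.rpow_le_rpow_of_exponent_le (by linarith) (by linarith)
    _ ≤ 1 / 2 := by
        rw [Real.rpow_neg_one, one_div]
        exact inv_anti₀ (by norm_num) h2

theorem LSeries.term_natCast_ofReal (a : ℕ → ℕ) {s : ℝ} (hs : s ≠ 0) (n : ℕ) :
    LSeries.term (fun n ↦ (a n : ℂ)) s n = ((a n * (n : ℝ) ^ (-s) : ℝ) : ℂ) := by
  rcases eq_or_ne n 0 with rfl | hn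
  · simp [Real.zero_rpow (neg_ne_zero.mpr hs)]
  · rw [LSeries.term_of_ne_zero hn, Real.rpow_neg (Nat.cast_nonneg _), div_eq_mul_inv]
    push_cast [Complex.ofReal_cpow (Nat.cast_nonneg n)]
    rfl

theorem hasSum_absNorm_rpow {s : ℝ}
    (h : Summable fun n : ℕ ↦
      (Nat.card {I : Ideal (𝓞 K) // Ideal.absNorm I = n} : ℝ) * (n : ℝ) ^ (-s)) :
    HasSum (fun I : Ideal (𝓞 K) ↦ (Ideal.absNorm I : ℝ) ^ (-s))
      (∑' n : ℕ, (Nat.card {I : Ideal (𝓞 K) // Ideal.absNorm I = n} : ℝ) * (n : ℝ) ^ (-s)) := by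
  have hfib (n : ℕ) : HasSum (fun I : {I : Ideal (𝓞 K) // Ideal.absNorm I = n} ↦
      (Ideal.absNorm I.1 : ℝ) ^ (-s))
      ((Nat.card {I : Ideal (𝓞 K) // Ideal.absNorm I = n} : ℝ) * (n : ℝ) ^ (-s)) := by
    have : Finite {I : Ideal (𝓞 K) // Ideal.absNorm I = n} := Ideal.finite_setOfPred_absNorm_eq n
    have := Fintype.ofFinite {I : Ideal (𝓞 K) // Ideal.absNorm I = n}
    simpa [Finset.sum_congr rfl fun (I : {I : Ideal (𝓞 K) // Ideal.absNorm I = n}) _ ↦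
      congrArg (fun m : ℕ ↦ (m : ℝ) ^ (-s)) I.2, Nat.card_eq_fintype_card] using
      hasSum_fintype fun I : {I : Ideal (𝓞 K) // Ideal.absNorm I = n} ↦
        (Ideal.absNorm I.1 : ℝ) ^ (-s)
  rw [← (Equiv.sigmaFiberEquiv (Ideal.absNorm : Ideal (𝓞 K) → ℕ)).hasSum_iff]
  have hsum : Summable ((fun I : Ideal (𝓞 K) ↦ (Ideal.absNorm I : ℝ) ^ (-s)) ∘
      Equiv.sigmaFiberEquiv (Ideal.absNorm : Ideal (𝓞 K) → ℕ)) := by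
    rw [summable_sigma_of_nonneg fun _ ↦ by simpa using by positivity]
    exact ⟨fun n ↦ (hfib n).summable, h.congr fun n ↦ (hfib n).tsum_eq.symm⟩
  convert! hsum.hasSum using 1
  rw [hsum.tsum_sigma]
  exact tsum_congr fun n ↦ (hfib n).tsum_eq.symm

variable (K)

theorem eventually_summable_absNorm_rpow_and_eq :
    ∀ᶠ s : ℝ in 𝓝[>] 1, Summable (fun I : Ideal (𝓞 K) ↦ (Ideal.absNorm I : ℝ) ^ (-s)) ∧
      NumberField.dedekindZeta K s =
        ((∑' I : Ideal (𝓞 K), (Ideal.absNorm I : ℝ) ^ (-s) : ℝ) : ℂ) := by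
  have hne : ∀ᶠ s : ℝ in 𝓝[>] 1, (s - 1) * NumberField.dedekindZeta K s ≠ 0 :=
    (NumberField.tendsto_sub_one_mul_dedekindZeta_nhdsGT K).eventually_ne
      (by exact_mod_cast NumberField.dedekindZeta_residue_ne_zero K)
  filter_upwards [hne, self_mem_nhdsWithin] with s hs hs1
  have hs0 : s ≠ 0 := (zero_lt_one.trans hs1).ne'
  have hz : NumberField.dedekindZeta K s ≠ 0 := right_ne_zero_of_mul hs
  have hterm := funext (LSeries.term_natCast_ofReal
    (fun n ↦ Nat.card {I : Ideal (𝓞 K) // Ideal.absNorm I = n}) hs0)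
  have hsum : Summable fun n : ℕ ↦
      (Nat.card {I : Ideal (𝓞 K) // Ideal.absNorm I = n} : ℝ) * (n : ℝ) ^ (-s) := by
    by_contra hcon
    apply hz
    rw [NumberField.dedekindZeta, LSeries, hterm]
    exact tsum_eq_zero_of_not_summable fun h ↦ hcon (Complex.summable_ofReal.mp h)
  have h := hasSum_absNorm_rpow hsum
  refine ⟨h.summable, ?_⟩
  rw [h.tsum_eq, NumberField.dedekindZeta, LSeries, hterm, Complex.ofReal_tsum]

theorem summable_absNorm_rpow {s : ℝ} (hs : 1 < s) :
    Summable (fun I : Ideal (𝓞 K) ↦ (Ideal.absNorm I : ℝ) ^ (-s)) := by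
  obtain ⟨t, ht, ht'⟩ := ((eventually_summable_absNorm_rpow_and_eq K).and
    (Ioo_mem_nhdsGT hs)).exists
  refine ht.1.of_nonneg_of_le (fun I ↦ by positivity) fun I ↦ ?_
  rcases Nat.eq_zero_or_pos (Ideal.absNorm I) with h | h
  · rw [h, Nat.cast_zero, Real.zero_rpow (by linarith), Real.zero_rpow (by linarith [ht'.1])]
  · exact Real.rpow_le_rpow_of_exponent_le (by exact_mod_cast h) (by linarith [ht'.2])

theorem summable_asIdeal_rpow {s : ℝ} (hs : 1 < s) :
    Summable (fun v : HeightOneSpectrum (𝓞 K) ↦ (Ideal.absNorm v.asIdeal : ℝ) ^ (-s)) :=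
  summable_comp_asIdeal (g := idealNormRpow K s (by linarith)) (summable_absNorm_rpow K hs)

theorem tendsto_sub_one_mul_tsum_absNorm_rpow :
    Tendsto (fun s : ℝ ↦ (s - 1) * ∑' I : Ideal (𝓞 K), (Ideal.absNorm I : ℝ) ^ (-s)) (𝓝[>] 1)
      (𝓝 (NumberField.dedekindZeta_residue K)) := by
  rw [← tendsto_ofReal_iff]
  refine (NumberField.tendsto_sub_one_mul_dedekindZeta_nhdsGT K).congr' ?_
  filter_upwards [eventually_summable_absNorm_rpow_and_eq K] with s hs
  rw [hs.2]
  push_cast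
  rfl

theorem tendsto_log_inv_sub_one_atTop :
    Tendsto (fun s : ℝ ↦ Real.log (s - 1)⁻¹) (𝓝[>] 1) atTop := by
  refine Real.tendsto_log_atTop.comp (tendsto_inv_nhdsGT_zero.comp ?_)
  refine tendsto_nhdsWithin_iff.mpr ⟨?_, ?_⟩
  · have : Tendsto (fun s : ℝ ↦ s - 1) (𝓝 1) (𝓝 (1 - 1)) := tendsto_id.sub_const 1
    rw [sub_self] at this
    exact this.mono_left nhdsWithin_le_nhds
  · filter_upwards [self_mem_nhdsWithin] with s hs using sub_pos.mpr (Set.mem_Ioi.mp hs)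

/-- The sum of `N(P) ^ (-s)` over all primes is `log (1 / (s - 1)) + O(1)` as `s → 1⁺`. -/
theorem exists_abs_tsum_asIdeal_rpow_sub_log_le :
    ∃ C : ℝ, ∀ᶠ s : ℝ in 𝓝[>] 1,
      |∑' v : HeightOneSpectrum (𝓞 K), (Ideal.absNorm v.asIdeal : ℝ) ^ (-s) -
        Real.log (s - 1)⁻¹| ≤ C := by
  set ρ := NumberField.dedekindZeta_residue K
  have hρ : 0 < ρ := NumberField.dedekindZeta_residue_pos K
  have hlog : Tendsto (fun s : ℝ ↦
      Real.log ((s - 1) * ∑' I : Ideal (𝓞 K), (Ideal.absNorm I : ℝ) ^ (-s))) (𝓝[>] 1)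
      (𝓝 (Real.log ρ)) :=
    (tendsto_sub_one_mul_tsum_absNorm_rpow K).log hρ.ne'
  let B := ∑' v : HeightOneSpectrum (𝓞 K), (Ideal.absNorm v.asIdeal : ℝ) ^ (-2 : ℝ)
  have hB : 0 ≤ B := tsum_nonneg fun v ↦ by positivity
  refine ⟨|Real.log ρ| + 1 + 2 * B, ?_⟩
  filter_upwards [hlog.eventually (Metric.ball_mem_nhds _ one_pos), self_mem_nhdsWithin]
    with s hs hs1
  replace hs1 : 1 < s := hs1
  have hs0 : s ≠ 0 := by linarith
  let g := idealNormRpow K s hs0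
  have hg : ∀ I, 0 ≤ g I := fun I ↦ Real.rpow_nonneg (Nat.cast_nonneg _) _
  have hle : ∀ v : HeightOneSpectrum (𝓞 K), g v.asIdeal ≤ 1 / 2 :=
    fun v ↦ absNorm_asIdeal_rpow_le_half v hs1.le
  have hsum : Summable g := summable_absNorm_rpow K hs1
  have h1 := tsum_asIdeal_le_log_tsum hg (fun v ↦ (hle v).trans_lt (by norm_num)) hsum
  have h2 := log_tsum_le_tsum_asIdeal hg hle hsum
  have h3 : ∑' v : HeightOneSpectrum (𝓞 K), g v.asIdeal ^ 2 ≤ B := by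
    have hpt (v : HeightOneSpectrum (𝓞 K)) :
        g v.asIdeal ^ 2 ≤ (Ideal.absNorm v.asIdeal : ℝ) ^ (-2 : ℝ) := by
      have h2 : (2 : ℝ) ≤ Ideal.absNorm v.asIdeal := by exact_mod_cast two_le_absNorm_asIdeal v
      change ((Ideal.absNorm v.asIdeal : ℝ) ^ (-s)) ^ 2 ≤ _
      rw [← Real.rpow_natCast, ← Real.rpow_mul (by linarith)]
      exact Real.rpow_le_rpow_of_exponent_le (by linarith) (by push_cast; linarith)
    have hB' := summable_asIdeal_rpow K (s := 2) (by norm_num)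
    exact (hB'.of_nonneg_of_le (fun v ↦ sq_nonneg _) hpt).tsum_le_tsum hpt hB'
  have h4 : Real.log ((s - 1) * ∑' I, g I) = Real.log (∑' I, g I) - Real.log (s - 1)⁻¹ := by
    rw [Real.log_mul (by linarith) (tsum_pos_of_nonneg hg hsum).ne', Real.log_inv]
    ring
  replace hs : |Real.log ((s - 1) * ∑' I, g I) - Real.log ρ| < 1 := hs
  rw [h4, abs_lt] at hs
  change |∑' v : HeightOneSpectrum (𝓞 K), g v.asIdeal - Real.log (s - 1)⁻¹| ≤ _
  have h5 := le_abs_self (Real.log ρ)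
  have h6 := neg_abs_le (Real.log ρ)
  rw [abs_le]
  constructor <;> linarith

end DedekindZeta

section SplitPrimesDensity

variable (K N : Type*) [Field K] [NumberField K] [Field N] [NumberField N] [Algebra K N]

omit [NumberField K] [NumberField N] in
variable {K N} in
theorem mem_primesOver_iff_under_eq (p : HeightOneSpectrum (𝓞 K)) (v : HeightOneSpectrum (𝓞 N)) :
    v.asIdeal ∈ p.asIdeal.primesOver (𝓞 N) ↔ v.under (𝓞 K) = p :=
  ⟨fun h ↦ HeightOneSpectrum.ext h.2.over.symm, fun h ↦ ⟨v.isPrime, ⟨by rw [← h]; rfl⟩⟩⟩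

variable {K} in
/-- The primes of `N` above `p`, as elements of the height one spectrum. -/
noncomputable def underFiberEquivPrimesOver (p : HeightOneSpectrum (𝓞 K)) :
    (HeightOneSpectrum.under (𝓞 K) (B := 𝓞 N) ⁻¹' {p}) ≃ p.asIdeal.primesOver (𝓞 N) where
  toFun v := ⟨v.1.asIdeal, (mem_primesOver_iff_under_eq p v.1).mpr v.2⟩
  invFun P := ⟨⟨P.1, P.2.1, Ideal.ne_bot_of_mem_primesOver p.ne_bot P.2⟩,
    (mem_primesOver_iff_under_eq p ⟨P.1, P.2.1, _⟩).mp P.2⟩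
  left_inv _ := rfl
  right_inv _ := rfl

theorem finite_ramified_primes :
    {p : HeightOneSpectrum (𝓞 K) | ∃ P ∈ p.asIdeal.primesOver (𝓞 N),
      P.ramificationIdx (𝓞 K) ≠ 1}.Finite := by
  have hfin := (Ideal.finite_factors
    (differentIdeal_ne_bot (A := 𝓞 K) (B := 𝓞 N))).image (HeightOneSpectrum.under (𝓞 K))
  refine hfin.subset ?_
  rintro p ⟨P, hP, hram⟩
  have := hP.1
  refine ⟨⟨P, hP.1, Ideal.ne_bot_of_mem_primesOver p.ne_bot hP⟩, ?_,
    (mem_primesOver_iff_under_eq p ⟨P, hP.1, _⟩).mp hP⟩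
  have : PerfectField (P.under (𝓞 K)).ResidueField := inferInstance
  exact dvd_differentIdeal_iff.mpr fun h ↦ hram (Ideal.ramificationIdx_eq_one_iff.mpr h)

variable [IsGalois K N]

variable {K N} in
theorem ncard_primesOver_mul_ramificationIdx_mul_inertiaDeg (p : HeightOneSpectrum (𝓞 K))
    {P : Ideal (𝓞 N)} (hP : P ∈ p.asIdeal.primesOver (𝓞 N)) :
    (p.asIdeal.primesOver (𝓞 N)).ncard * (P.ramificationIdx (𝓞 K) * P.inertiaDeg (𝓞 K)) =
      Module.finrank K N := by
  have := hP.1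
  have := hP.2
  have := p.isPrime
  rw [← IsGalois.card_aut_eq_finrank K N,
    ← Ideal.ncard_primesOver_mul_ramificationIdxIn_mul_inertiaDegIn p.asIdeal (𝓞 N) Gal(N/K),
    Ideal.ramificationIdxIn_eq_ramificationIdx p.asIdeal P Gal(N/K),
    Ideal.inertiaDegIn_eq_inertiaDeg p.asIdeal P Gal(N/K)]

variable {K N} in
theorem mem_splittingPrimes_of_exists {p : HeightOneSpectrum (𝓞 K)} {P : Ideal (𝓞 N)}
    (hP : P ∈ p.asIdeal.primesOver (𝓞 N)) (he : P.ramificationIdx (𝓞 K) = 1)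
    (hf : P.inertiaDeg (𝓞 K) = 1) : p ∈ splittingPrimes K N := by
  intro Q hQ
  have := hP.1
  have := hP.2
  have := hQ.1
  have := hQ.2
  have := p.isPrime
  rw [Ideal.ramificationIdx_eq_of_isGaloisGroup p.asIdeal Q P Gal(N/K),
    Ideal.inertiaDeg_eq_of_isGaloisGroup p.asIdeal Q P Gal(N/K)]
  exact ⟨he, hf⟩

variable {K N} in
theorem ncard_primesOver_le_finrank (p : HeightOneSpectrum (𝓞 K)) :
    (p.asIdeal.primesOver (𝓞 N)).ncard ≤ Module.finrank K N := by
  have := p.isPrime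
  obtain ⟨P⟩ := (inferInstance : Nonempty (p.asIdeal.primesOver (𝓞 N)))
  rw [← ncard_primesOver_mul_ramificationIdx_mul_inertiaDeg p P.2]
  have := P.2.1
  exact Nat.le_mul_of_pos_right _
    (Nat.mul_pos (P.1.ramificationIdx_pos (𝓞 K)) (P.1.inertiaDeg_pos (𝓞 K)))

variable {K N} in
theorem ncard_primesOver_eq_finrank {p : HeightOneSpectrum (𝓞 K)}
    (hp : p ∈ splittingPrimes K N) :
    (p.asIdeal.primesOver (𝓞 N)).ncard = Module.finrank K N := by
  have := p.isPrime
  obtain ⟨P⟩ := (inferInstance : Nonempty (p.asIdeal.primesOver (𝓞 N)))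
  rw [← ncard_primesOver_mul_ramificationIdx_mul_inertiaDeg p P.2, (hp P.1 P.2).1,
    (hp P.1 P.2).2, mul_one, mul_one]

/-- The sum of `N(P) ^ (-s)` over the primes `P` of `N` above `p`. -/
noncomputable def primesAboveSum (s : ℝ) (p : HeightOneSpectrum (𝓞 K)) : ℝ :=
  ∑' v : (HeightOneSpectrum.under (𝓞 K) (B := 𝓞 N) ⁻¹' {p}),
    (Ideal.absNorm v.1.asIdeal : ℝ) ^ (-s)

omit [NumberField K] [IsGalois K N] in
theorem primesAboveSum_eq_tsum_primesOver (s : ℝ) (p : HeightOneSpectrum (𝓞 K)) :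
    primesAboveSum K N s p =
      ∑' P : p.asIdeal.primesOver (𝓞 N), (Ideal.absNorm P.1 : ℝ) ^ (-s) :=
  (underFiberEquivPrimesOver N p).tsum_eq
    fun P : p.asIdeal.primesOver (𝓞 N) ↦ (Ideal.absNorm P.1 : ℝ) ^ (-s)

omit [NumberField K] [IsGalois K N] in
theorem primesAboveSum_nonneg (s : ℝ) (p : HeightOneSpectrum (𝓞 K)) :
    0 ≤ primesAboveSum K N s p :=
  tsum_nonneg fun _ ↦ by positivity

theorem primesAboveSum_eq_of_mem_splittingPrimes {p : HeightOneSpectrum (𝓞 K)}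
    (hp : p ∈ splittingPrimes K N) (s : ℝ) :
    primesAboveSum K N s p = Module.finrank K N * (Ideal.absNorm p.asIdeal : ℝ) ^ (-s) := by
  have hconst (P : p.asIdeal.primesOver (𝓞 N)) :
      (Ideal.absNorm P.1 : ℝ) ^ (-s) = (Ideal.absNorm p.asIdeal : ℝ) ^ (-s) := by
    have := P.2.1
    have := P.2.2
    rw [← Ideal.absNorm_pow_inertiaDeg p.asIdeal P.1, (hp P.1 P.2).2, pow_one]
  rw [primesAboveSum_eq_tsum_primesOver, tsum_congr hconst, tsum_const, Nat.card_coe_set_eq,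
    ncard_primesOver_eq_finrank hp, nsmul_eq_mul]

theorem primesAboveSum_le_of_forall_le {p : HeightOneSpectrum (𝓞 K)} {s c : ℝ} (hc : 0 ≤ c)
    (h : ∀ P ∈ p.asIdeal.primesOver (𝓞 N), (Ideal.absNorm P : ℝ) ^ (-s) ≤ c) :
    primesAboveSum K N s p ≤ Module.finrank K N * c := by
  have := p.isPrime
  have hfin : Finite (p.asIdeal.primesOver (𝓞 N)) :=
    (Algebra.QuasiFinite.finite_primesOver p.asIdeal).to_subtype
  rw [primesAboveSum_eq_tsum_primesOver]
  calc ∑' P : p.asIdeal.primesOver (𝓞 N), (Ideal.absNorm P.1 : ℝ) ^ (-s)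
      ≤ ∑' _ : p.asIdeal.primesOver (𝓞 N), c :=
        Summable.tsum_le_tsum (fun P ↦ h P.1 P.2) .of_finite .of_finite
    _ = (p.asIdeal.primesOver (𝓞 N)).ncard * c := by
        rw [tsum_const, Nat.card_coe_set_eq, nsmul_eq_mul]
    _ ≤ Module.finrank K N * c :=
        mul_le_mul_of_nonneg_right (Nat.cast_le.mpr (ncard_primesOver_le_finrank p)) hc

omit [IsGalois K N] in
theorem absNorm_rpow_le_one {P : Ideal (𝓞 N)} (hP : P ≠ ⊥) {s : ℝ} (hs : 0 ≤ s) :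
    (Ideal.absNorm P : ℝ) ^ (-s) ≤ 1 := by
  refine Real.rpow_le_one_of_one_le_of_nonpos ?_ (by linarith)
  exact_mod_cast Nat.one_le_iff_ne_zero.mpr (Ideal.absNorm_eq_zero_iff.not.mpr hP)

omit [IsGalois K N] in
variable {K N} in
theorem absNorm_rpow_le_of_two_le_inertiaDeg {p : HeightOneSpectrum (𝓞 K)} {P : Ideal (𝓞 N)}
    (hP : P ∈ p.asIdeal.primesOver (𝓞 N)) (hf : 2 ≤ P.inertiaDeg (𝓞 K)) {s : ℝ} (hs : 1 ≤ s) :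
    (Ideal.absNorm P : ℝ) ^ (-s) ≤ (Ideal.absNorm p.asIdeal : ℝ) ^ (-2 : ℝ) := by
  have := hP.1
  have := hP.2
  have h2 : (2 : ℝ) ≤ Ideal.absNorm p.asIdeal := by exact_mod_cast two_le_absNorm_asIdeal p
  have hf' : (2 : ℝ) ≤ P.inertiaDeg (𝓞 K) := by exact_mod_cast hf
  rw [← Ideal.absNorm_pow_inertiaDeg p.asIdeal P, Nat.cast_pow, ← Real.rpow_natCast,
    ← Real.rpow_mul (by linarith)]
  exact Real.rpow_le_rpow_of_exponent_le (by linarith) (by nlinarith)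

theorem primesAboveSum_le {p : HeightOneSpectrum (𝓞 K)} (hp : p ∉ splittingPrimes K N) {s : ℝ}
    (hs : 1 ≤ s) :
    primesAboveSum K N s p ≤ Module.finrank K N * ((Ideal.absNorm p.asIdeal : ℝ) ^ (-2 : ℝ) +
      {p : HeightOneSpectrum (𝓞 K) | ∃ P ∈ p.asIdeal.primesOver (𝓞 N),
        P.ramificationIdx (𝓞 K) ≠ 1}.indicator 1 p) := by
  have hnn : 0 ≤ (Ideal.absNorm p.asIdeal : ℝ) ^ (-2 : ℝ) := by positivity
  by_cases hram : ∃ P ∈ p.asIdeal.primesOver (𝓞 N), P.ramificationIdx (𝓞 K) ≠ 1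
  · rw [Set.indicator_of_mem (by exact hram), Pi.one_apply]
    refine primesAboveSum_le_of_forall_le K N (by linarith) fun P hP ↦ ?_
    have := absNorm_rpow_le_one N (Ideal.ne_bot_of_mem_primesOver p.ne_bot hP)
      (zero_le_one.trans hs)
    linarith
  · rw [Set.indicator_of_notMem (by exact hram), add_zero]
    push Not at hram
    refine primesAboveSum_le_of_forall_le K N hnn fun P hP ↦ ?_
    refine absNorm_rpow_le_of_two_le_inertiaDeg hP ?_ hs
    have := hP.1
    have h1 : P.inertiaDeg (𝓞 K) ≠ 1 := fun h ↦ hp (mem_splittingPrimes_of_exists hP (hram P hP) h)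
    have h0 := P.inertiaDeg_pos (𝓞 K)
    omega

/-- In a Galois extension `N/K` of number fields, the primes that split completely account for
all but a bounded part of the sum of `N(P) ^ (-s)` over the primes of `N`. -/
theorem exists_abs_tsum_sub_finrank_mul_le :
    ∃ C : ℝ, ∀ s : ℝ, 1 < s →
      |∑' v : HeightOneSpectrum (𝓞 N), (Ideal.absNorm v.asIdeal : ℝ) ^ (-s) -
        Module.finrank K N * NumberField.Set.primeIdealZetaSum (splittingPrimes K N) s| ≤ C := by
  set ram : HeightOneSpectrum (𝓞 K) → ℝ :=
    {p : HeightOneSpectrum (𝓞 K) | ∃ P ∈ p.asIdeal.primesOver (𝓞 N),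
      P.ramificationIdx (𝓞 K) ≠ 1}.indicator 1
  have hram : Summable ram :=
    summable_of_hasFiniteSupport ((finite_ramified_primes K N).subset Set.support_indicator_subset)
  have htwo := summable_asIdeal_rpow K (s := 2) (by norm_num)
  have hram0 (p : HeightOneSpectrum (𝓞 K)) : 0 ≤ ram p :=
    Set.indicator_nonneg (fun _ _ ↦ zero_le_one) p
  set n : ℝ := (Module.finrank K N : ℝ)
  have hn0 : 0 ≤ n := Nat.cast_nonneg _
  let B := fun p : HeightOneSpectrum (𝓞 K) ↦
    n * ((Ideal.absNorm p.asIdeal : ℝ) ^ (-2 : ℝ) + ram p)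
  have hB : Summable B := (htwo.add hram).mul_left n
  refine ⟨∑' p, B p, fun s hs ↦ ?_⟩
  have hfib := ((summable_asIdeal_rpow N hs).hasSum.tsum_fiberwise
    (HeightOneSpectrum.under (𝓞 K) (B := 𝓞 N)))
  change HasSum (primesAboveSum K N s) _ at hfib
  have hA := ((summable_asIdeal_rpow K hs).indicator (splittingPrimes K N)).mul_left n
  rw [NumberField.Set.primeIdealZetaSum_def,
    tsum_subtype (splittingPrimes K N) fun p ↦ (Ideal.absNorm p.asIdeal : ℝ) ^ (-s),
    ← tsum_mul_left, ← hfib.tsum_eq, ← hfib.summable.tsum_sub hA]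
  have hpt (p : HeightOneSpectrum (𝓞 K)) :
      0 ≤ primesAboveSum K N s p - n * (splittingPrimes K N).indicator
          (fun p ↦ (Ideal.absNorm p.asIdeal : ℝ) ^ (-s)) p ∧
        primesAboveSum K N s p - n * (splittingPrimes K N).indicator
          (fun p ↦ (Ideal.absNorm p.asIdeal : ℝ) ^ (-s)) p ≤ B p := by
    by_cases hp : p ∈ splittingPrimes K N
    · rw [Set.indicator_of_mem hp, primesAboveSum_eq_of_mem_splittingPrimes K N hp, sub_self]
      exact ⟨le_rfl, mul_nonneg hn0 (add_nonneg (by positivity) (hram0 p))⟩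
    · rw [Set.indicator_of_notMem hp, mul_zero, sub_zero]
      exact ⟨primesAboveSum_nonneg K N s p, primesAboveSum_le K N hp hs.le⟩
  rw [abs_of_nonneg (tsum_nonneg fun p ↦ (hpt p).1)]
  exact (hfib.summable.sub hA).tsum_le_tsum (fun p ↦ (hpt p).2) hB

/-- The primes that split completely in a Galois extension `N/K` have density `1 / [N : K]`. -/
theorem tendsto_primeIdealZetaSum_splittingPrimes_div_log :
    Tendsto (fun s : ℝ ↦ NumberField.Set.primeIdealZetaSum (splittingPrimes K N) s /
      Real.log (s - 1)⁻¹) (𝓝[>] 1) (𝓝 (Module.finrank K N : ℝ)⁻¹) := by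
  obtain ⟨C, hC⟩ := exists_abs_tsum_sub_finrank_mul_le K N
  obtain ⟨D, hD⟩ := exists_abs_tsum_asIdeal_rpow_sub_log_le N
  have hn : (Module.finrank K N : ℝ) ≠ 0 := Nat.cast_ne_zero.mpr Module.finrank_pos.ne'
  have hlog := tendsto_log_inv_sub_one_atTop
  have hlim : Tendsto (fun s : ℝ ↦ (Module.finrank K N *
      NumberField.Set.primeIdealZetaSum (splittingPrimes K N) s - Real.log (s - 1)⁻¹) /
        Real.log (s - 1)⁻¹) (𝓝[>] 1) (𝓝 0) := by
    refine squeeze_zero_norm' ?_ (hlog.const_div_atTop (C + D))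
    filter_upwards [hD, self_mem_nhdsWithin, hlog.eventually_gt_atTop 0] with s hs hs1 hs0
    rw [norm_div, Real.norm_eq_abs, Real.norm_eq_abs, abs_of_pos hs0]
    refine div_le_div_of_nonneg_right ?_ hs0.le
    have h1 := abs_le.mp (hC s hs1)
    have h2 := abs_le.mp hs
    rw [abs_le]
    constructor <;> linarith
  have := (hlim.add_const 1).mul_const (Module.finrank K N : ℝ)⁻¹
  rw [zero_add, one_mul] at this
  refine this.congr' ?_
  filter_upwards [hlog.eventually_gt_atTop 0] with s hs0
  generalize Real.log (s - 1)⁻¹ = l at hs0 ⊢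
  field_simp
  ring

end SplitPrimesDensity

theorem finrank_le_of_splittingPrimes_subset {K L M : Type*} [Field K] [NumberField K]
    [Field L] [NumberField L] [Algebra K L] [Field M] [NumberField M] [Algebra K M]
    [IsGalois K L] [IsGalois K M]
    (h : splittingPrimes K L ⊆ splittingPrimes K M) :
    Module.finrank K M ≤ Module.finrank K L := by
  have hL := tendsto_primeIdealZetaSum_splittingPrimes_div_log K L
  have hM := tendsto_primeIdealZetaSum_splittingPrimes_div_log K M
  have hle : (Module.finrank K L : ℝ)⁻¹ ≤ (Module.finrank K M : ℝ)⁻¹ := by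
    refine le_of_tendsto_of_tendsto hL hM ?_
    filter_upwards [self_mem_nhdsWithin,
      (tendsto_log_inv_sub_one_atTop).eventually_gt_atTop 0] with s hs hs'
    refine div_le_div_of_nonneg_right ?_ hs'.le
    have hsum := summable_asIdeal_rpow K (Set.mem_Ioi.mp hs)
    simp only [NumberField.Set.primeIdealZetaSum_def]
    rw [tsum_subtype (splittingPrimes K L) fun p ↦ (Ideal.absNorm p.asIdeal : ℝ) ^ (-s),
      tsum_subtype (splittingPrimes K M) fun p ↦ (Ideal.absNorm p.asIdeal : ℝ) ^ (-s)]
    exact (hsum.indicator _).tsum_le_tsum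
      (Set.indicator_le_indicator_of_subset h fun p ↦ by positivity) (hsum.indicator _)
  have hposL : 0 < (Module.finrank K L : ℝ) := Nat.cast_pos.mpr Module.finrank_pos
  have hposM : 0 < (Module.finrank K M : ℝ) := Nat.cast_pos.mpr Module.finrank_pos
  exact_mod_cast (inv_le_inv₀ hposL hposM).mp hle

section Tower

variable {K L L' M : Type*} [Field K] [NumberField K] [Field L] [NumberField L] [Algebra K L]
  [Field L'] [NumberField L'] [Algebra K L'] [Field M] [NumberField M] [Algebra K M]
  [Algebra L M] [IsScalarTower K L M] [Algebra L' M] [IsScalarTower K L' M]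

omit [NumberField K] [NumberField M] in
variable (K L M) in
theorem splittingPrimes_subset_of_isScalarTower : splittingPrimes K M ⊆ splittingPrimes K L := by
  intro p hp P hP
  have := hP.1
  have := hP.2
  obtain ⟨Q, hQ, hQP⟩ := (inferInstance : Nonempty (P.primesOver (𝓞 M)))
  have hQp : Q.LiesOver p.asIdeal := .trans Q P p.asIdeal
  obtain ⟨he, hf⟩ := hp Q ⟨hQ, hQp⟩
  rw [Ideal.ramificationIdx_tower P Q] at he
  rw [Ideal.inertiaDeg_tower P Q] at hf
  exact ⟨Nat.eq_one_of_mul_eq_one_right he, Nat.eq_one_of_mul_eq_one_right hf⟩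

open scoped Pointwise in
theorem eq_one_of_smul_eq_of_mem_splittingPrimes [IsGalois K L] {p : HeightOneSpectrum (𝓞 K)}
    (hp : p ∈ splittingPrimes K L) {P : Ideal (𝓞 L)} (hP : P ∈ p.asIdeal.primesOver (𝓞 L))
    {σ : Gal(L/K)} (hσ : σ • P = P) : σ = 1 := by
  have := hP.1
  have := hP.2
  have := p.isPrime
  have hcard : Nat.card (MulAction.stabilizer Gal(L/K) P) = 1 := by
    rw [Ideal.card_stabilizer_eq p.asIdeal P,
      Ideal.ramificationIdxIn_eq_ramificationIdx p.asIdeal P Gal(L/K),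
      Ideal.inertiaDegIn_eq_inertiaDeg p.asIdeal P Gal(L/K), (hp P hP).1, (hp P hP).2]
  rw [Subgroup.card_eq_one] at hcard
  simpa [hcard] using (MulAction.mem_stabilizer_iff.mpr hσ : σ ∈ MulAction.stabilizer Gal(L/K) P)

open scoped Pointwise in
theorem algebraMap_fixed_of_smul_eq [IsGalois K L] [IsGalois K M] {p : HeightOneSpectrum (𝓞 K)}
    (hp : p ∈ splittingPrimes K L) {Q : Ideal (𝓞 M)} (hQ : Q ∈ p.asIdeal.primesOver (𝓞 M))
    {σ : Gal(M/K)} (hσ : σ • Q = Q) (x : L) : σ (algebraMap L M x) = algebraMap L M x := by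
  have := hQ.1
  have := hQ.2
  let r := IsGaloisGroup.restrictHom Gal(M/K) Gal(L/K) (𝓞 K) (𝓞 L) (𝓞 M)
  have hr : r σ = 1 := by
    refine eq_one_of_smul_eq_of_mem_splittingPrimes hp (P := Q.under (𝓞 L))
      ⟨inferInstance, Ideal.LiesOver.tower_bot Q _ p.asIdeal⟩ ?_
    rw [IsGaloisGroup.restrictHom_smul_under, hσ]
  have hint (y : 𝓞 L) : σ (algebraMap L M (y : L)) = algebraMap L M (y : L) := by
    have h := IsGaloisGroup.algebraMap_restrictHom_smul Gal(M/K) Gal(L/K) (𝓞 K) (𝓞 L) (𝓞 M) σ y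
    change algebraMap (𝓞 L) (𝓞 M) (r σ • y) = _ at h
    rw [hr, one_smul] at h
    exact (congrArg (algebraMap (𝓞 M) M) h).symm
  obtain ⟨a, b, _, rfl⟩ := IsFractionRing.div_surjective (𝓞 L) x
  simp only [map_div₀]
  rw [hint a, hint b]

open scoped Pointwise in
theorem inter_subset_splittingPrimes [IsGalois K L] [IsGalois K L'] [IsGalois K M]
    (hM : ∀ σ : Gal(M/K), (∀ x : L, σ (algebraMap L M x) = algebraMap L M x) →
      (∀ x : L', σ (algebraMap L' M x) = algebraMap L' M x) → σ = 1) :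
    splittingPrimes K L ∩ splittingPrimes K L' ⊆ splittingPrimes K M := by
  rintro p ⟨hp, hp'⟩ Q hQ
  have := hQ.1
  have := hQ.2
  have := p.isPrime
  have hcard : Nat.card (MulAction.stabilizer Gal(M/K) Q) = 1 := by
    rw [Subgroup.card_eq_one, Subgroup.eq_bot_iff_forall]
    intro σ hσ
    exact hM σ (algebraMap_fixed_of_smul_eq hp hQ hσ) (algebraMap_fixed_of_smul_eq hp' hQ hσ)
  rw [Ideal.card_stabilizer_eq p.asIdeal Q,
    Ideal.ramificationIdxIn_eq_ramificationIdx p.asIdeal Q Gal(M/K),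
    Ideal.inertiaDegIn_eq_inertiaDeg p.asIdeal Q Gal(M/K)] at hcard
  exact ⟨Nat.eq_one_of_mul_eq_one_right hcard, Nat.eq_one_of_mul_eq_one_left hcard⟩

end Tower

section IntermediateFields

variable {K Ω : Type*} [Field K] [NumberField K] [Field Ω] [Algebra K Ω]

theorem splittingPrimes_anti {L L' : IntermediateField K Ω} (hL : L ∈ finiteNormalExtensions K Ω)
    (hL' : L' ∈ finiteNormalExtensions K Ω) (h : L ≤ L') :
    splittingPrimes K L' ⊆ splittingPrimes K L := by
  have := hL.1
  have := hL'.1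
  have := NumberField.of_module_finite K L
  have := NumberField.of_module_finite K L'
  let := (IntermediateField.inclusion h).toAlgebra
  have : IsScalarTower K L L' :=
    .of_algebraMap_eq' (IntermediateField.inclusion h).comp_algebraMap.symm
  exact splittingPrimes_subset_of_isScalarTower K L L'

/-- **Bauer's theorem** for finite normal extensions. -/
theorem le_of_splittingPrimes_subset {L L' : IntermediateField K Ω}
    (hL : L ∈ finiteNormalExtensions K Ω) (hL' : L' ∈ finiteNormalExtensions K Ω)
    (h : splittingPrimes K L' ⊆ splittingPrimes K L) : L ≤ L' := by
  obtain ⟨_, _⟩ := hL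
  obtain ⟨_, _⟩ := hL'
  have : FiniteDimensional K ↥(L ⊔ L') := inferInstance
  have : Normal K ↥(L ⊔ L') := inferInstance
  have : IsGalois K L := {}
  have : IsGalois K L' := {}
  have : IsGalois K ↥(L ⊔ L') := {}
  have := NumberField.of_module_finite K L
  have := NumberField.of_module_finite K L'
  have := NumberField.of_module_finite K ↥(L ⊔ L')
  let := (IntermediateField.inclusion (le_sup_left : L ≤ L ⊔ L')).toAlgebra
  let := (IntermediateField.inclusion (le_sup_right : L' ≤ L ⊔ L')).toAlgebra
  have : IsScalarTower K L ↥(L ⊔ L') := .of_algebraMap_eq'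
    (IntermediateField.inclusion le_sup_left).comp_algebraMap.symm
  have : IsScalarTower K L' ↥(L ⊔ L') := .of_algebraMap_eq'
    (IntermediateField.inclusion le_sup_right).comp_algebraMap.symm
  have hsub : splittingPrimes K L ∩ splittingPrimes K L' ⊆ splittingPrimes K ↥(L ⊔ L') := by
    refine inter_subset_splittingPrimes fun σ h1 h2 ↦ ?_
    let E : IntermediateField K ↥(L ⊔ L') :=
      (AlgHom.equalizer (σ : ↥(L ⊔ L') →ₐ[K] ↥(L ⊔ L')) (.id K _)).toIntermediateField
        fun x hx ↦ by
          rw [AlgHom.mem_equalizer] at hx ⊢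
          rw [map_inv₀, map_inv₀, hx]
    have hle : L ⊔ L' ≤ IntermediateField.lift E := sup_le
      (fun x hx ↦ (IntermediateField.mem_lift ⟨x, le_sup_left (a := L) hx⟩).mpr (h1 ⟨x, hx⟩))
      (fun x hx ↦ (IntermediateField.mem_lift ⟨x, le_sup_right (a := L) hx⟩).mpr (h2 ⟨x, hx⟩))
    ext x
    exact congrArg Subtype.val ((IntermediateField.mem_lift x).mp (hle x.2) : σ x = x)
  have hrank : Module.finrank K ↥(L ⊔ L') ≤ Module.finrank K L' :=
    finrank_le_of_splittingPrimes_subset fun p hp ↦ hsub ⟨h hp, hp⟩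
  exact sup_eq_right.mp (IntermediateField.eq_of_le_of_finrank_le le_sup_right hrank).symm

end IntermediateFields

theorem corollary4 (K Ω : Type*) [Field K] [NumberField K] [Field Ω] [Algebra K Ω] :
    (∀ L ∈ finiteNormalExtensions K Ω, ∀ L' ∈ finiteNormalExtensions K Ω,
      splittingPrimes K L = splittingPrimes K L' → L = L') ∧
    ∃ e : finiteNormalExtensions K Ω ≃
        (fun L : IntermediateField K Ω => splittingPrimes K L) '' finiteNormalExtensions K Ω,
      (∀ L : finiteNormalExtensions K Ω,
        (e L : Set (IsDedekindDomain.HeightOneSpectrum (𝓞 K))) =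
          splittingPrimes K (L : IntermediateField K Ω)) ∧
      (∀ L L' : finiteNormalExtensions K Ω,
        (L : IntermediateField K Ω) ≤ (L' : IntermediateField K Ω) ↔
          (e L' : Set (IsDedekindDomain.HeightOneSpectrum (𝓞 K))) ⊆
            (e L : Set (IsDedekindDomain.HeightOneSpectrum (𝓞 K)))) := by
  have hinj : ∀ L ∈ finiteNormalExtensions K Ω, ∀ L' ∈ finiteNormalExtensions K Ω,
      splittingPrimes K L = splittingPrimes K L' → L = L' := fun L hL L' hL' h ↦
    le_antisymm (le_of_splittingPrimes_subset hL hL' h.ge)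
      (le_of_splittingPrimes_subset hL' hL h.le)
  refine ⟨hinj, Equiv.Set.imageOfInjOn _ _ fun L hL L' hL' h ↦ hinj L hL L' hL' h,
    fun L ↦ rfl, fun L L' ↦ ?_⟩
  exact ⟨splittingPrimes_anti L.2 L'.2, le_of_splittingPrimes_subset L.2 L'.2⟩
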